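/- Let $V$ be a finite-dimensional complex vector space and let $k\in\mathbb{N}$. Let $\mathbb{T}((V))=\prod_{n\ge 0}V^{\otimes n}$ be the algebra of formal tensor series, with multiplication given by the tensor product. Let $\mathrm{Lie}(V)\subset\mathbb{T}((V))$ be the Lie subalgebra, with respect to the commutator bracket, generated by $V=V^{\otimes 1}$; put $\mathrm{Lie}^nV=\mathrm{Lie}(V)\cap V^{\otimes n}$, and call the elements of $\mathrm{Lie}((V))=\prod_{n}\mathrm{Lie}^nV$ Lie series. The universal signature variety $\mathcal{U}_k(V)\subseteq V^{\otimes k}$ is the set of level-$k$ components of $\exp(\mathcal{T})=\sum_{m\ge 0}\mathcal{T}^{\otimes m}/m!$, where $\mathcal{T}$ ranges over $\mathrm{Lie}((V))$. The rank of $T\in V^{\otimes k}$ is the smallest $r$ such that $T$ is a sum of $r$ elementary tensors $v_1\otimes\cdots\otimes v_k$, and $T$ is symmetric if it is fixed by all permutations of the $k$ tensor factors. (1) Let $T\in\mathcal{U}_k(V)$ be nonzero. Then $T$ has rank $1$ if and only if $T$ is symmetric. (2) In the projective space $\mathbb{P}(V^{\otimes k})$, the set-theoretic intersection of the projectivized universal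 variety $\{[T]\mid 0\ne T\in\mathcal{U}_k(V)\}$ with the Segre variety $\{[T]\mid \operatorname{rk}(T)=1\}$ is exactly the Veronese variety $\{[v^{\otimes k}]\mid v\in V,\ v^{\otimes k}\neq 0\}$. -/

import Mathlib

open scoped TensorProduct

noncomputable section

/-- Formal tensor series over `V`: the product over all `n : ℕ` of the tensor powers of `V`. -/
def TensorSeries (V : Type*) [AddCommGroup V] [Module ℂ V] : Type _ :=
  (n : ℕ) → (⨂[ℂ]^n V)

namespace TensorSeries

variable {V : Type*} [AddCommGroup V] [Module ℂ V]

instance instAddCommGroup : AddCommGroup (TensorSeries V) :=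
  inferInstanceAs (AddCommGroup ((n : ℕ) → (⨂[ℂ]^n V)))

instance instModule : Module ℂ (TensorSeries V) :=
  inferInstanceAs (Module ℂ ((n : ℕ) → (⨂[ℂ]^n V)))

/-- The inclusion of the `n`-th tensor power as the series concentrated in level `n`. -/
def single (n : ℕ) : (⨂[ℂ]^n V) →ₗ[ℂ] TensorSeries V :=
  LinearMap.single ℂ (fun n : ℕ => (⨂[ℂ]^n V)) n

/-- The projection of a tensor series to its `n`-th level. -/
def level (n : ℕ) : TensorSeries V →ₗ[ℂ] (⨂[ℂ]^n V) :=
  LinearMap.proj (φ := fun n : ℕ => (⨂[ℂ]^n V)) n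

theorem ext {S T : TensorSeries V} (h : ∀ n, level n S = level n T) : S = T :=
  funext h

/-- The multiplication given by the tensor product of tensors: level `n` of `S * T` is the sum of
all `S i ⊗ T j` with `i + j = n`. -/
instance instMul : Mul (TensorSeries V) where
  mul S T := fun n => ∑ p : Finset.HasAntidiagonal.antidiagonal n,
    TensorPower.cast ℂ V (Finset.HasAntidiagonal.mem_antidiagonal.1 p.2)
      (GradedMonoid.GMul.mul (A := fun i : ℕ => (⨂[ℂ]^i V)) (level p.1.1 S) (level p.1.2 T))

instance instOne : One (TensorSeries V) where
  one := single 0 (PiTensorProduct.tprod ℂ (fun i : Fin 0 => i.elim0))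

theorem level_mul (S T : TensorSeries V) (n : ℕ) :
    level n (S * T) = ∑ p : Finset.HasAntidiagonal.antidiagonal n,
      TensorPower.cast ℂ V (Finset.HasAntidiagonal.mem_antidiagonal.1 p.2)
        (GradedMonoid.GMul.mul (A := fun i : ℕ => (⨂[ℂ]^i V)) (level p.1.1 S) (level p.1.2 T)) :=
  rfl

/-- Auxiliary embedding into power series over the tensor algebra, used only to transfer the ring
axioms. -/
def toPowerSeries (T : TensorSeries V) : PowerSeries (TensorAlgebra ℂ V) :=
  PowerSeries.mk fun n => TensorPower.toTensorAlgebra (level n T)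

theorem toTensorAlgebra_cast {i j : ℕ} (h : i = j) (x : ⨂[ℂ]^i V) :
    TensorPower.toTensorAlgebra (TensorPower.cast ℂ V h x) = TensorPower.toTensorAlgebra x := by
  subst h
  simp

theorem toTensorAlgebra_injective (n : ℕ) :
    Function.Injective (TensorPower.toTensorAlgebra : (⨂[ℂ]^n V) →ₗ[ℂ] TensorAlgebra ℂ V) := by
  intro x y h
  have key : ∀ z : ⨂[ℂ]^n V, TensorAlgebra.ofDirectSum
      (DirectSum.of (fun n : ℕ => (⨂[ℂ]^n V)) n z) = TensorPower.toTensorAlgebra z := by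
    intro z
    simp [TensorAlgebra.ofDirectSum, DirectSum.toAlgebra, DirectSum.toSemiring]
  rw [← key, ← key] at h
  have h2 := congrArg TensorAlgebra.toDirectSum h
  rw [TensorAlgebra.toDirectSum_ofDirectSum, TensorAlgebra.toDirectSum_ofDirectSum] at h2
  exact DirectSum.of_injective n h2

theorem toPowerSeries_injective :
    Function.Injective (toPowerSeries : TensorSeries V → PowerSeries (TensorAlgebra ℂ V)) := by
  intro S T h
  refine ext fun n => toTensorAlgebra_injective n ?_
  simpa [toPowerSeries] using congrArg (PowerSeries.coeff n) h

theorem toPowerSeries_add (S T : TensorSeries V) :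
    toPowerSeries (S + T) = toPowerSeries S + toPowerSeries T := by
  ext n
  simp [toPowerSeries]

theorem toPowerSeries_zero : toPowerSeries (0 : TensorSeries V) = 0 := by
  ext n
  simp [toPowerSeries]

theorem toPowerSeries_one : toPowerSeries (1 : TensorSeries V) = 1 := by
  ext n
  rw [PowerSeries.coeff_one]
  rcases eq_or_ne n 0 with rfl | hn
  · have : level 0 (1 : TensorSeries V)
        = PiTensorProduct.tprod ℂ (fun i : Fin 0 => i.elim0) :=
      Pi.single_eq_same (M := fun n : ℕ => (⨂[ℂ]^n V)) 0 _
    simp [toPowerSeries, this]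
  · have : level n (1 : TensorSeries V) = 0 :=
      Pi.single_eq_of_ne (M := fun n : ℕ => (⨂[ℂ]^n V)) hn _
    simp [toPowerSeries, this, hn]

theorem toPowerSeries_mul (S T : TensorSeries V) :
    toPowerSeries (S * T) = toPowerSeries S * toPowerSeries T := by
  ext n
  rw [PowerSeries.coeff_mul, ← Finset.sum_coe_sort]
  simp [toPowerSeries, level_mul, toTensorAlgebra_cast, TensorPower.toTensorAlgebra_gMul]

instance instRing : Ring (TensorSeries V) :=
  { instAddCommGroup, instMul, instOne with
    left_distrib := fun a b c => toPowerSeries_injective (by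
      simp only [toPowerSeries_mul, toPowerSeries_add, mul_add])
    right_distrib := fun a b c => toPowerSeries_injective (by
      simp only [toPowerSeries_mul, toPowerSeries_add, add_mul])
    zero_mul := fun a => toPowerSeries_injective (by
      simp only [toPowerSeries_mul, toPowerSeries_zero, zero_mul])
    mul_zero := fun a => toPowerSeries_injective (by
      simp only [toPowerSeries_mul, toPowerSeries_zero, mul_zero])
    mul_assoc := fun a b c => toPowerSeries_injective (by
      simp only [toPowerSeries_mul, mul_assoc])
    one_mul := fun a => toPowerSeries_injective (by
      simp only [toPowerSeries_mul, toPowerSeries_one, one_mul])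
    mul_one := fun a => toPowerSeries_injective (by
      simp only [toPowerSeries_mul, toPowerSeries_one, mul_one]) }

theorem toPowerSeries_smul (c : ℂ) (S : TensorSeries V) :
    toPowerSeries (c • S) = c • toPowerSeries S := by
  ext n
  simp [toPowerSeries]

instance instAlgebra : Algebra ℂ (TensorSeries V) :=
  Algebra.ofModule
    (fun r x y => toPowerSeries_injective (by
      simp only [toPowerSeries_mul, toPowerSeries_smul, smul_mul_assoc]))
    (fun r x y => toPowerSeries_injective (by
      simp only [toPowerSeries_mul, toPowerSeries_smul, mul_smul_comm]))

/-- The commutator bracket `⁅S, T⁆ = S * T - T * S`. -/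
instance instLieRing : LieRing (TensorSeries V) :=
  LieRing.ofAssociativeRing

instance instLieAlgebra : LieAlgebra ℂ (TensorSeries V) :=
  LieAlgebra.ofAssociativeAlgebra

/-- If `T` has no constant term, then the terms `T ^ m` with `m > n` do not contribute to level
`n`, so that the exponential series is a finite sum in each level. -/
theorem level_pow_eq_zero {T : TensorSeries V} (hT : level 0 T = 0) {m n : ℕ} (h : n < m) :
    level n (T ^ m) = 0 := by
  induction m generalizing n with
  | zero => omega
  | succ m ih =>
    rw [pow_succ, level_mul]
    refine Finset.sum_eq_zero fun p _ => ?_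
    have hp := Finset.HasAntidiagonal.mem_antidiagonal.1 p.2
    by_cases h0 : p.1.2 = 0
    · have : level p.1.2 T = 0 := by rw [h0]; exact hT
      rw [this, TensorPower.gMul_def]
      simp
    · rw [ih (by omega), TensorPower.gMul_def]
      simp

/-- The exponential `∑ T ^ m / m!` of a tensor series `T` without constant term; only the terms
with `m ≤ n` contribute to level `n`. -/
def exp (T : TensorSeries V) : TensorSeries V :=
  fun n => ∑ m ∈ Finset.range (n + 1), ((m.factorial : ℂ)⁻¹) • level n (T ^ m)

variable (V)

/-- The free Lie algebra on `V`: the Lie subalgebra of the tensor series, with the commutator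
bracket, that is generated by `V` (sitting in level one). -/
def freeLie : LieSubalgebra ℂ (TensorSeries V) :=
  LieSubalgebra.lieSpan ℂ (TensorSeries V)
    (Set.range fun v : V => single 1 (PiTensorProduct.tprod ℂ (fun _ : Fin 1 => v)))

/-- The homogeneous Lie polynomials of degree `n`, as a subspace of the `n`-th tensor power. -/
def lieLevel (n : ℕ) : Submodule ℂ (⨂[ℂ]^n V) :=
  (freeLie V).toSubmodule.comap (single n)

/-- The Lie series: the tensor series all of whose levels are Lie polynomials. -/
def lieSeries : Submodule ℂ (TensorSeries V) where
  carrier := {T | ∀ n, level n T ∈ lieLevel V n}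
  zero_mem' := fun n => by rw [map_zero]; exact zero_mem _
  add_mem' := fun hS hT n => by rw [map_add]; exact add_mem (hS n) (hT n)
  smul_mem' := fun c _ hT n => by rw [map_smul]; exact Submodule.smul_mem _ c (hT n)

end TensorSeries

/-- The universal signature variety: all level-`k` parts of exponentials of Lie series. -/
def universalVariety (V : Type*) [AddCommGroup V] [Module ℂ V] (k : ℕ) : Set (⨂[ℂ]^k V) :=
  (fun T => TensorSeries.level k (TensorSeries.exp T)) '' (TensorSeries.lieSeries V : Set _)

section Tensors

variable {V : Type*} [AddCommGroup V] [Module ℂ V] {k : ℕ}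

/-- An elementary tensor `v₁ ⊗ ⋯ ⊗ vₖ`. -/
def IsElementaryTensor (T : ⨂[ℂ]^k V) : Prop :=
  ∃ v : Fin k → V, T = PiTensorProduct.tprod ℂ v

/-- The rank of a tensor: the minimal number of elementary tensors summing to it (the value `⊤`
is taken when there is no such sum, which can happen for `k = 0` only). -/
def tensorRank (T : ⨂[ℂ]^k V) : ℕ∞ :=
  ⨅ r ∈ {r : ℕ | ∃ E : Fin r → (⨂[ℂ]^k V), (∀ i, IsElementaryTensor (E i)) ∧ T = ∑ i, E i},
    (r : ℕ∞)

/-- A symmetric tensor: one that is fixed by all permutations of the tensor factors. -/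
def IsSymmetricTensor (T : ⨂[ℂ]^k V) : Prop :=
  ∀ σ : Equiv.Perm (Fin k), PiTensorProduct.reindex ℂ (fun _ : Fin k => V) σ T = T

/-- The projectivization of a set `X` of tensors: all points `[T]` with `0 ≠ T ∈ X`. -/
def projectivizedSet (X : Set (⨂[ℂ]^k V)) :
    Set (Projectivization ℂ (⨂[ℂ]^k V)) :=
  {p | ∃ (T : ⨂[ℂ]^k V) (hT : T ≠ 0), T ∈ X ∧ p = Projectivization.mk ℂ T hT}

end Tensors

section Projective

variable (V : Type*) [AddCommGroup V] [Module ℂ V] (k : ℕ)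

/-- The Segre variety: all points `[T]` with `T` of rank one. -/
def segreVariety : Set (Projectivization ℂ (⨂[ℂ]^k V)) :=
  projectivizedSet {T : ⨂[ℂ]^k V | tensorRank T = 1}

/-- The Veronese variety: all points `[v ⊗ ⋯ ⊗ v]` with `v` in `V`. -/
def veroneseVariety : Set (Projectivization ℂ (⨂[ℂ]^k V)) :=
  projectivizedSet (Set.range fun v : V => PiTensorProduct.tprod ℂ (fun _ : Fin k => v))

end Projective

end

/-!
A linear map `φ` from `V` to a commutative algebra `R` extends multiplicatively to all tensors
(`TensorSeries.contract`) and, with one power of a formal variable for each tensor factor, to a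
ring homomorphism from tensor series to `R⟦X⟧` (`TensorSeries.toCommSeries`). Since `R` is
commutative, commutators are sent to zero, so a Lie series with degree one part `g` is sent to
`φ g * X`. Comparing coefficients of `exp`, every `T` in the universal variety satisfies
`φ(T) = φ(g) ^ k / k!` for all `φ` (`exists_contract_eq_of_mem_universalVariety`).

* Let `T = v₁ ⊗ ⋯ ⊗ vₖ ≠ 0`. Taking `R = ℂ` gives `∏ φ(vᵢ) = φ(g) ^ k / k!` for all functionals
  `φ`. Some functional vanishes at no `vᵢ`, hence `g ≠ 0`. If some `vᵢ` were not proportional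
  to `g`, a functional killing `vᵢ` but not `g` would give a contradiction. So `T` is a multiple of
  `g ⊗ ⋯ ⊗ g` and in particular symmetric.
* Let `T` be symmetric. Sending a basis of `V` to the variables of a polynomial ring is injective on
  symmetric tensors (`IsSymmetricTensor.eq_zero_of_contract_X_eq_zero`), and the symmetric tensors
  `T` and `(g ⊗ ⋯ ⊗ g) / k!` have the same image, so they agree.

Hence the nonzero elements of the universal variety that have rank one, and those that are
symmetric, are exactly those of the form `(g ⊗ ⋯ ⊗ g) / k!`. Conversely every such tensor is the
level `k` part of the exponential of the Lie series `g`.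
-/

/-! ### Contracting tensor series into a commutative algebra -/

namespace TensorSeries

variable {V : Type*} [AddCommGroup V] [Module ℂ V] {R : Type*} [CommRing R] [Algebra ℂ R]

/-- The multiplicative extension `v₁ ⊗ ⋯ ⊗ vₙ ↦ φ v₁ * ⋯ * φ vₙ` of a linear map `φ` into a
commutative algebra. -/
noncomputable def contract (φ : V →ₗ[ℂ] R) (n : ℕ) : (⨂[ℂ]^n V) →ₗ[ℂ] R :=
  (TensorAlgebra.lift ℂ φ).toLinearMap ∘ₗ TensorPower.toTensorAlgebra

theorem contract_tprod (φ : V →ₗ[ℂ] R) {n : ℕ} (v : Fin n → V) :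
    contract φ n (PiTensorProduct.tprod ℂ v) = ∏ i, φ (v i) := by
  simp [contract, TensorPower.toTensorAlgebra_tprod, TensorAlgebra.tprod_apply, map_list_prod,
    List.map_ofFn, List.prod_ofFn]

/-- The extension of `φ : V → R` to a map from tensor series to `R⟦X⟧`, the power of `X`
recording the level. -/
noncomputable def toCommSeries (φ : V →ₗ[ℂ] R) (T : TensorSeries V) : PowerSeries R :=
  PowerSeries.map (TensorAlgebra.lift ℂ φ).toRingHom (toPowerSeries T)

theorem coeff_toCommSeries (φ : V →ₗ[ℂ] R) (T : TensorSeries V) (n : ℕ) :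
    PowerSeries.coeff n (toCommSeries φ T) = contract φ n (level n T) := by
  simp [toCommSeries, toPowerSeries, contract]

theorem toCommSeries_mul (φ : V →ₗ[ℂ] R) (S T : TensorSeries V) :
    toCommSeries φ (S * T) = toCommSeries φ S * toCommSeries φ T := by
  simp [toCommSeries, toPowerSeries_mul]

theorem toCommSeries_pow (φ : V →ₗ[ℂ] R) (T : TensorSeries V) (m : ℕ) :
    toCommSeries φ (T ^ m) = toCommSeries φ T ^ m := by
  induction m with
  | zero => simp [toCommSeries, toPowerSeries_one]
  | succ m ih => rw [pow_succ, pow_succ, toCommSeries_mul, ih]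

theorem level_single_same (n : ℕ) (x : ⨂[ℂ]^n V) : level n (single n x) = x :=
  Pi.single_eq_same (M := fun n : ℕ => (⨂[ℂ]^n V)) n x

theorem level_single_of_ne {m n : ℕ} (h : m ≠ n) (x : ⨂[ℂ]^n V) : level m (single n x) = 0 :=
  Pi.single_eq_of_ne (M := fun n : ℕ => (⨂[ℂ]^n V)) h x

/-- Elements of the free Lie algebra have no image outside degree one, because commutators become
zero in a commutative algebra. -/
theorem contract_level_eq_zero_of_mem_freeLie (φ : V →ₗ[ℂ] R) {T : TensorSeries V}
    (hT : T ∈ freeLie V) {n : ℕ} (hn : n ≠ 1) : contract φ n (level n T) = 0 := by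
  induction hT using LieSubalgebra.lieSpan_induction with
  | mem x hx =>
    obtain ⟨v, rfl⟩ := hx
    simp only [level_single_of_ne hn, map_zero]
  | zero => simp only [map_zero]
  | add x y _ _ hx hy => simp only [map_add, hx, hy, add_zero]
  | smul a x _ hx => simp only [map_smul, hx, smul_zero]
  | lie x y _ _ _ _ =>
    rw [LieRing.of_associative_ring_bracket, map_sub, map_sub, ← coeff_toCommSeries,
      ← coeff_toCommSeries, toCommSeries_mul, toCommSeries_mul, mul_comm, sub_self]

theorem toCommSeries_of_mem_lieSeries (φ : V →ₗ[ℂ] R) {T : TensorSeries V}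
    (hT : T ∈ lieSeries V) :
    toCommSeries φ T = PowerSeries.monomial 1 (contract φ 1 (level 1 T)) := by
  ext n
  rw [coeff_toCommSeries, PowerSeries.coeff_monomial]
  split_ifs with h
  · subst h; rfl
  · simpa only [level_single_same] using contract_level_eq_zero_of_mem_freeLie φ (hT n) h

theorem contract_level_exp_of_mem_lieSeries (φ : V →ₗ[ℂ] R) {T : TensorSeries V}
    (hT : T ∈ lieSeries V) (k : ℕ) :
    contract φ k (level k (exp T)) =
      ((k.factorial : ℂ)⁻¹) • contract φ 1 (level 1 T) ^ k := by
  have hlevel : level k (exp T) =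
      ∑ m ∈ Finset.range (k + 1), ((m.factorial : ℂ)⁻¹) • level k (T ^ m) := rfl
  simp only [hlevel, map_sum, map_smul, ← coeff_toCommSeries φ (_ ^ _), toCommSeries_pow,
    toCommSeries_of_mem_lieSeries φ hT, PowerSeries.monomial_pow, PowerSeries.coeff_monomial]
  simp

/-- The exponential of the Lie series `v` has level `k` part `v ⊗ ⋯ ⊗ v / k!`. -/
theorem level_exp_single_one (v : V) (k : ℕ) :
    level k (exp (single 1 (PiTensorProduct.tprod ℂ fun _ : Fin 1 => v))) =
      ((k.factorial : ℂ)⁻¹) • PiTensorProduct.tprod ℂ fun _ : Fin k => v := by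
  set T := single 1 (PiTensorProduct.tprod ℂ fun _ : Fin 1 => v) with hT
  have hlevel : level k (exp T) =
      ∑ m ∈ Finset.range (k + 1), ((m.factorial : ℂ)⁻¹) • level k (T ^ m) := rfl
  have hseries : toPowerSeries T =
      PowerSeries.C (TensorAlgebra.ι ℂ v) * PowerSeries.X := by
    ext n
    rw [PowerSeries.coeff_C_mul, PowerSeries.coeff_X]
    split_ifs with h
    · subst h
      simp [toPowerSeries, hT, level_single_same, TensorAlgebra.tprod_apply]
    · simp [toPowerSeries, hT, level_single_of_ne h]
  have hpow (m : ℕ) : toPowerSeries (T ^ m) =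
      PowerSeries.C (TensorAlgebra.ι ℂ v ^ m) * PowerSeries.X ^ m := by
    have h : toPowerSeries (T ^ m) = toPowerSeries T ^ m := by
      induction m with
      | zero => rw [pow_zero, pow_zero, toPowerSeries_one]
      | succ m ih => rw [pow_succ, pow_succ, toPowerSeries_mul, ih]
    rw [h, hseries, (PowerSeries.commute_X _).mul_pow, map_pow]
  have hcoeff (m : ℕ) : TensorPower.toTensorAlgebra (level k (T ^ m)) =
      if k = m then TensorAlgebra.ι ℂ v ^ m else 0 := by
    rw [← PowerSeries.coeff_C_mul_X_pow, ← hpow, toPowerSeries, PowerSeries.coeff_mk]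
  apply toTensorAlgebra_injective
  simp only [hlevel, map_sum, map_smul, hcoeff]
  simp [TensorAlgebra.tprod_apply]

end TensorSeries

open TensorSeries

section

variable {V : Type*} [AddCommGroup V] [Module ℂ V] {k : ℕ}

theorem smul_tprod_const_mem_universalVariety (v : V) :
    ((k.factorial : ℂ)⁻¹) • (PiTensorProduct.tprod ℂ fun _ : Fin k => v) ∈
      universalVariety V k := by
  refine ⟨single 1 (PiTensorProduct.tprod ℂ fun _ : Fin 1 => v), fun n => ?_,
    level_exp_single_one v k⟩
  rcases eq_or_ne n 1 with rfl | hn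
  · rw [level_single_same]
    exact LieSubalgebra.subset_lieSpan ⟨v, rfl⟩
  · rw [level_single_of_ne hn]
    exact zero_mem _

/-- All contractions of a point of the universal variety are governed by the degree one part `g` of
the Lie series. -/
theorem exists_contract_eq_of_mem_universalVariety {T : ⨂[ℂ]^k V}
    (hT : T ∈ universalVariety V k) :
    ∃ g : V, ∀ {R : Type} [CommRing R] [Algebra ℂ R] (φ : V →ₗ[ℂ] R),
      contract φ k T = ((k.factorial : ℂ)⁻¹) • φ g ^ k := by
  obtain ⟨L, hL, rfl⟩ := hT
  refine ⟨PiTensorProduct.subsingletonEquiv (0 : Fin 1) (level 1 L), fun φ => ?_⟩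
  have hg : level 1 L = PiTensorProduct.tprod ℂ fun _ : Fin 1 =>
      PiTensorProduct.subsingletonEquiv (R := ℂ) (0 : Fin 1) (level 1 L) := by
    rw [← PiTensorProduct.subsingletonEquiv_symm_apply' (0 : Fin 1), LinearEquiv.symm_apply_apply]
  rw [contract_level_exp_of_mem_lieSeries φ hL]
  conv_lhs => rw [hg, contract_tprod]
  simp

/-! ### Symmetric tensors -/

theorem isSymmetricTensor_smul_tprod_const (c : ℂ) (v : V) :
    IsSymmetricTensor (c • PiTensorProduct.tprod ℂ fun _ : Fin k => v) := by
  intro σ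
  rw [map_smul, PiTensorProduct.reindex_tprod]

theorem IsSymmetricTensor.sub {S T : ⨂[ℂ]^k V} (hS : IsSymmetricTensor S)
    (hT : IsSymmetricTensor T) : IsSymmetricTensor (S - T) := by
  intro σ
  rw [map_sub, hS σ, hT σ]

theorem piTensorProduct_repr_reindex {ι : Type*} (b : Module.Basis ι ℂ V)
    (σ : Equiv.Perm (Fin k)) (T : ⨂[ℂ]^k V) (f : Fin k → ι) :
    (Basis.piTensorProduct fun _ : Fin k => b).repr
        (PiTensorProduct.reindex ℂ (fun _ : Fin k => V) σ T) f =
      (Basis.piTensorProduct fun _ : Fin k => b).repr T (f ∘ σ) := by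
  induction T using PiTensorProduct.induction_on with
  | smul_tprod r v =>
    rw [map_smul, PiTensorProduct.reindex_tprod, map_smul, map_smul, Finsupp.smul_apply,
      Finsupp.smul_apply, Basis.piTensorProduct_repr_tprod_apply,
      Basis.piTensorProduct_repr_tprod_apply]
    congr 1
    exact Fintype.prod_equiv σ.symm _ _ fun i => by simp
  | add S T hS hT => simp only [map_add, Finsupp.add_apply, hS, hT]

theorem exists_perm_of_sum_single_eq {ι : Type*} {f g : Fin k → ι}
    (h : ∑ i, Finsupp.single (f i) 1 = ∑ i, Finsupp.single (g i) (1 : ℕ)) :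
    ∃ σ : Equiv.Perm (Fin k), g ∘ σ = f := by
  classical
  have hcard (j : ι) : Nonempty ({i // f i = j} ≃ {i // g i = j}) := by
    rw [← Fintype.card_eq]
    simpa [Finsupp.finsetSum_apply, Finsupp.single_apply, Fintype.card_subtype] using
      DFunLike.congr_fun h j
  exact ⟨Equiv.ofFiberEquiv fun j => (hcard j).some,
    funext fun i => Equiv.ofFiberEquiv_map _ i⟩

/-- A symmetric tensor is determined by the polynomial it defines. The coefficient of a monomial is
the sum of the tensor coordinates over all index words with that content; these coordinates are
all equal by symmetry. -/
theorem IsSymmetricTensor.eq_zero_of_contract_X_eq_zero {ι : Type*} [Fintype ι]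
    (b : Module.Basis ι ℂ V) {T : ⨂[ℂ]^k V} (hT : IsSymmetricTensor T)
    (h : contract (b.constr ℂ (MvPolynomial.X : ι → MvPolynomial ι ℂ)) k T = 0) : T = 0 := by
  classical
  set B := Basis.piTensorProduct fun _ : Fin k => b
  refine B.ext_elem fun f => ?_
  have hsum : ∑ g : Fin k → ι,
      MvPolynomial.monomial (∑ i, Finsupp.single (g i) 1) (B.repr T g) = 0 := by
    rw [← h]
    conv_rhs => rw [← B.sum_repr T]
    rw [map_sum]
    refine Finset.sum_congr rfl fun g _ => ?_
    rw [map_smul, Basis.piTensorProduct_apply, contract_tprod]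
    simp only [Module.Basis.constr_basis]
    rw [MvPolynomial.monomial_sum_index, ← MvPolynomial.C_mul']
    rfl
  have hcoeff := congrArg (MvPolynomial.coeff (∑ i, Finsupp.single (f i) 1)) hsum
  have hconst : ∀ g ∈ Finset.univ.filter fun g : Fin k → ι =>
      ∑ i, Finsupp.single (g i) 1 = ∑ i, Finsupp.single (f i) (1 : ℕ),
      B.repr T g = B.repr T f := by
    intro g hg
    obtain ⟨σ, rfl⟩ := exists_perm_of_sum_single_eq (Finset.mem_filter.1 hg).2
    rw [← piTensorProduct_repr_reindex b σ T f, hT σ]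
  rw [MvPolynomial.coeff_sum] at hcoeff
  simp only [MvPolynomial.coeff_monomial, MvPolynomial.coeff_zero] at hcoeff
  rw [← Finset.sum_filter, Finset.sum_congr rfl hconst, Finset.sum_const, smul_eq_zero] at hcoeff
  have hne : (Finset.univ.filter fun g : Fin k → ι =>
      ∑ i, Finsupp.single (g i) 1 = ∑ i, Finsupp.single (f i) (1 : ℕ)).card ≠ 0 :=
    Finset.card_ne_zero_of_mem (a := f) (by simp)
  simpa using hcoeff.resolve_left hne

/-! ### Tensors of rank one -/

theorem tensorRank_eq_one_iff {T : ⨂[ℂ]^k V} (hT : T ≠ 0) :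
    tensorRank T = 1 ↔ IsElementaryTensor T := by
  have hlow : 1 ≤ tensorRank T := by
    refine le_iInf₂ fun r hr => ?_
    obtain ⟨E, -, hE⟩ := hr
    rcases r with _ | r
    · exact absurd (by simpa using hE) hT
    · exact_mod_cast Nat.le_add_left 1 r
  constructor
  · intro h
    by_contra hel
    have h2 : (2 : ℕ∞) ≤ tensorRank T := by
      refine le_iInf₂ fun r hr => ?_
      obtain ⟨E, hE, hsum⟩ := hr
      rcases r with _ | _ | r
      · exact absurd (by simpa using hsum) hT
      · exact absurd (by simpa [hsum] using hE 0) hel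
      · exact_mod_cast Nat.le_add_left 2 r
    rw [h] at h2
    exact absurd h2 (by decide)
  · intro h
    refine le_antisymm ?_ hlow
    exact iInf₂_le_of_le 1 ⟨fun _ => T, fun _ => h, by simp⟩ (by simp)

/-- For `k = 0` the scalar `c` has to be excluded from scaling a factor, as there is none. -/
theorem IsElementaryTensor.smul {T : ⨂[ℂ]^k V} (hT : IsElementaryTensor T) (hk : k ≠ 0) (c : ℂ) :
    IsElementaryTensor (c • T) := by
  obtain ⟨v, rfl⟩ := hT
  let i : Fin k := ⟨0, Nat.pos_of_ne_zero hk⟩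
  refine ⟨Function.update v i (c • v i), ?_⟩
  rw [MultilinearMap.map_update_smul, Function.update_eq_self]

theorem IsElementaryTensor.inv_factorial_smul {T : ⨂[ℂ]^k V} (hT : IsElementaryTensor T) :
    IsElementaryTensor (((k.factorial : ℂ)⁻¹) • T) := by
  rcases eq_or_ne k 0 with rfl | hk
  · simpa using hT
  · exact hT.smul hk _

/-- A nonzero elementary tensor in the universal variety is symmetric: its factors are all
proportional to the degree one part of the Lie series. -/
theorem IsElementaryTensor.isSymmetricTensor {T : ⨂[ℂ]^k V} (hel : IsElementaryTensor T)
    (hT : T ∈ universalVariety V k) (h0 : T ≠ 0) : IsSymmetricTensor T := by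
  rcases eq_or_ne k 0 with rfl | hk
  · intro σ
    rw [Subsingleton.elim σ (Equiv.refl _), PiTensorProduct.reindex_refl]
    rfl
  obtain ⟨v, rfl⟩ := hel
  obtain ⟨g, hg⟩ := exists_contract_eq_of_mem_universalVariety hT
  have hprod (φ : V →ₗ[ℂ] ℂ) : ∏ i, φ (v i) = (k.factorial : ℂ)⁻¹ * φ g ^ k := by
    rw [← contract_tprod, hg, smul_eq_mul]
  have hv (i : Fin k) : v i ≠ 0 := fun hi =>
    h0 ((PiTensorProduct.tprod ℂ).map_coord_zero i hi)
  have hg0 : g ≠ 0 := by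
    rintro rfl
    obtain ⟨φ, hφ⟩ := Module.exists_dual_forall_apply_ne_zero (K := ℂ) v hv
    exact Finset.prod_ne_zero_iff.2 (fun i _ => hφ i) ((hprod φ).trans (by simp [hk]))
  have hpar (i : Fin k) : ∃ c : ℂ, v i = c • g := by
    have hmem : g ∈ Submodule.span ℂ {v i} := by
      by_contra hnot
      obtain ⟨φ, hφg, hφ⟩ := Submodule.exists_le_ker_of_notMem hnot
      have hφv : φ (v i) = 0 := hφ (Submodule.mem_span_singleton_self _)
      have := hprod φ
      rw [Finset.prod_eq_zero (Finset.mem_univ i) hφv] at this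
      simp [hφg, k.factorial_ne_zero] at this
    obtain ⟨a, rfl⟩ := Submodule.mem_span_singleton.1 hmem
    have ha : a ≠ 0 := fun ha => hg0 (by simp [ha])
    exact ⟨a⁻¹, by rw [smul_smul, inv_mul_cancel₀ ha, one_smul]⟩
  choose c hc using hpar
  rw [show v = fun i => c i • g from funext hc, MultilinearMap.map_smul_univ]
  exact isSymmetricTensor_smul_tprod_const _ g

theorem IsSymmetricTensor.exists_eq_smul_tprod_const [FiniteDimensional ℂ V] {T : ⨂[ℂ]^k V}
    (hsymm : IsSymmetricTensor T) (hT : T ∈ universalVariety V k) :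
    ∃ g : V, T = ((k.factorial : ℂ)⁻¹) • PiTensorProduct.tprod ℂ fun _ : Fin k => g := by
  obtain ⟨g, hg⟩ := exists_contract_eq_of_mem_universalVariety hT
  refine ⟨g, sub_eq_zero.1 ?_⟩
  refine (hsymm.sub (isSymmetricTensor_smul_tprod_const _ g)).eq_zero_of_contract_X_eq_zero
    (Module.finBasis ℂ V) ?_
  rw [map_sub, map_smul, hg, contract_tprod]
  simp

end

theorem mainTheorem1 (V : Type*) [AddCommGroup V] [Module ℂ V] [FiniteDimensional ℂ V] (k : ℕ) :
    (∀ T : ⨂[ℂ]^k V, T ∈ universalVariety V k → T ≠ 0 →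
      (tensorRank T = 1 ↔ IsSymmetricTensor T)) ∧
    projectivizedSet (universalVariety V k) ∩ segreVariety V k = veroneseVariety V k := by
  have hiff : ∀ T : ⨂[ℂ]^k V, T ∈ universalVariety V k → T ≠ 0 →
      (tensorRank T = 1 ↔ IsSymmetricTensor T) := by
    intro T hT h0
    rw [tensorRank_eq_one_iff h0]
    refine ⟨fun h => h.isSymmetricTensor hT h0, fun h => ?_⟩
    obtain ⟨g, rfl⟩ := h.exists_eq_smul_tprod_const hT
    exact IsElementaryTensor.inv_factorial_smul ⟨_, rfl⟩
  refine ⟨hiff, Set.ext fun p => ⟨?_, ?_⟩⟩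
  · rintro ⟨⟨T, h0, hT, rfl⟩, S, hS0, hS, hTS⟩
    have hel : IsElementaryTensor S := (tensorRank_eq_one_iff hS0).1 hS
    have hsymm : IsSymmetricTensor T := by
      rcases eq_or_ne k 0 with rfl | hk
      · intro σ
        rw [Subsingleton.elim σ (Equiv.refl _), PiTensorProduct.reindex_refl]
        rfl
      · obtain ⟨c, rfl⟩ := (Projectivization.mk_eq_mk_iff' ℂ _ _ h0 hS0).1 hTS
        exact (hel.smul hk c).isSymmetricTensor hT h0
    obtain ⟨g, rfl⟩ := hsymm.exists_eq_smul_tprod_const hT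
    refine ⟨PiTensorProduct.tprod ℂ fun _ => g, right_ne_zero_of_smul h0, ⟨g, rfl⟩, ?_⟩
    exact (Projectivization.mk_eq_mk_iff' ℂ _ _ _ _).2 ⟨_, rfl⟩
  · rintro ⟨_, h0, ⟨v, rfl⟩, rfl⟩
    have hfact : ((k.factorial : ℂ)⁻¹) ≠ 0 := inv_ne_zero (by exact_mod_cast k.factorial_ne_zero)
    refine ⟨⟨_, smul_ne_zero hfact h0, smul_tprod_const_mem_universalVariety v, ?_⟩,
      _, h0, (tensorRank_eq_one_iff h0).2 ⟨_, rfl⟩, rfl⟩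
    exact ((Projectivization.mk_eq_mk_iff' ℂ _ _ _ _).2 ⟨_, rfl⟩).symm
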